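/- Let $d\ge 2$, let $S^d$ be the unit sphere of $\mathbb{R}^{d+1}$ with the spherical distance $|ab|$ (the angle between $a$ and $b$), and let $0<\delta<\frac{\pi}{2}$. Write $\operatorname{diam}(A)=\sup_{a,b\in A}|ab|$. A hemisphere is a set $\{x\in S^d: |cx|\le\frac{\pi}{2}\}$ with $c \in S^d$. A subset of $S^d$ is convex if it contains no pair of antipodes and, with any two of its points, the shorter great circle arc connecting them. A convex body is a closed convex subset of $S^d$ with non-empty interior. A subset $K$ of a hemisphere with $\operatorname{diam}(K)=\delta$ is complete of diameter $\delta$ if $\operatorname{diam}(K\cup\{x\})>\delta$ for every $x\in S^d\setminus K$. A convex body $K$ is of constant diameter $\delta$ if $\operatorname{diam}(K)=\delta$ and for every $p\in\operatorname{bd}(K)$ there is $p'\in\operatorname{bd}(K)$ with $|pp'|=\delta$. A convex body $K$ is of constant width $\delta$ if for every hemisphere $G\supset K$ with $\operatorname{bd}(G)\cap K\ne\emptyset$, the minimum thickness of a lune $G\cap H$ with $H$ a hemisphere containing $K$, different from and not opposite to $G$, equals $\delta$; here the thickness of $G\cap H$ is the spherical distance between the centers of the $(d-1)$-dimensional hemispheres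 $\operatorname{bd}(G)\cap H$ and $\operatorname{bd}(H)\cap G$. Then, for every set $K\subset S^d$: 1. $K$ is a convex body of constant diameter $\delta$ if and only if $K$ is complete of diameter $\delta$; 2. $K$ is a convex body of constant diameter $\delta$ if and only if $K$ is a convex body of constant width $\delta$. -/

import Mathlib

/-- The unit sphere `S^d` of the `(d+1)`-dimensional Euclidean space. -/
abbrev Sph (d : ℕ) : Type := Metric.sphere (0 : EuclideanSpace ℝ (Fin (d + 1))) 1

namespace Sph

/-- The spherical distance: the length of the shorter great circle arc from `a` to `b`, that is,
the angle between the two unit vectors. (The metric that the sphere inherits from the ambient space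
is the chordal one; it is used for the topology only.) -/
noncomputable def sdist {d : ℕ} (a b : Sph d) : ℝ :=
  InnerProductGeometry.angle (a : EuclideanSpace ℝ (Fin (d + 1))) b

/-- The spherical diameter of a set: the supremum of the spherical distances of its points
(which are bounded by `π`). -/
noncomputable def diam {d : ℕ} (A : Set (Sph d)) : ℝ :=
  sSup {t : ℝ | ∃ a ∈ A, ∃ b ∈ A, t = sdist a b}

/-- The arc `ab`, for `a` and `b` not antipodal: the part of the great circle through `a` and `b`
that is spanned by `a` and `b` with nonnegative coefficients. -/
def arc {d : ℕ} (a b : Sph d) : Set (Sph d) :=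
  {x | ∃ s t : ℝ, 0 ≤ s ∧ 0 ≤ t ∧
    (x : EuclideanSpace ℝ (Fin (d + 1))) =
      s • (a : EuclideanSpace ℝ (Fin (d + 1))) + t • (b : EuclideanSpace ℝ (Fin (d + 1)))}

/-- Spherically convex sets: no pair of antipodes, and every arc between two points. -/
def IsConvex {d : ℕ} (C : Set (Sph d)) : Prop :=
  ∀ a ∈ C, ∀ b ∈ C, b ≠ -a ∧ arc a b ⊆ C

/-- Convex bodies: closed convex sets with nonempty interior. -/
structure IsConvexBody {d : ℕ} (C : Set (Sph d)) : Prop where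
  isClosed : IsClosed C
  isConvex : IsConvex C
  nonempty_interior : (interior C).Nonempty

/-- The hemisphere with center `c`. -/
def hemisphere {d : ℕ} (c : Sph d) : Set (Sph d) :=
  {x | sdist c x ≤ Real.pi / 2}

/-- A set `K` of diameter `δ` (for `0 < δ < π / 2`) contained in a hemisphere is complete if adding
any extra point increases the diameter. -/
structure IsComplete {d : ℕ} (K : Set (Sph d)) (δ : ℝ) : Prop where
  subset_hemisphere : ∃ c, K ⊆ hemisphere c
  diam_eq : diam K = δ
  lt_diam_insert : ∀ x, x ∉ K → δ < diam (K ∪ {x})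

/-- A convex body of constant diameter `δ`. -/
structure IsConstantDiameter {d : ℕ} (D : Set (Sph d)) (δ : ℝ) : Prop where
  isConvexBody : IsConvexBody D
  diam_eq : diam D = δ
  exists_sdist_eq : ∀ p ∈ frontier D, ∃ p' ∈ frontier D, sdist p p' = δ

/-- The hemisphere with center `g` supports `C`. -/
def Supports {d : ℕ} (g : Sph d) (C : Set (Sph d)) : Prop :=
  C ⊆ hemisphere g ∧ (frontier (hemisphere g) ∩ C).Nonempty

/-- Let `G` and `H` be the hemispheres with centers `g` and `h`. The point `c` is the center of the
`(d-1)`-dimensional hemisphere `bd(G) ∩ H`, one of the two that bound the lune `G ∩ H`. -/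
def IsFacetCenter {d : ℕ} (g h c : Sph d) : Prop :=
  c ∈ frontier (hemisphere g) ∧
    frontier (hemisphere g) ∩ hemisphere h =
      {x | x ∈ frontier (hemisphere g) ∧ sdist c x ≤ Real.pi / 2}

/-- The hemispheres `G` and `H` with centers `g` and `h` are different and not opposite, and
the lune `G ∩ H` has thickness `t`: the spherical distance of the centers of the two
`(d-1)`-dimensional hemispheres that bound it is `t`. -/
def LuneHasThickness {d : ℕ} (g h : Sph d) (t : ℝ) : Prop :=
  g ≠ h ∧ g ≠ -h ∧ ∃ c c' : Sph d, IsFacetCenter g h c ∧ IsFacetCenter h g c' ∧ t = sdist c c'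

/-- The width of `C` determined by the hemisphere `G` with center `g` is `w`: the minimum thickness
of a lune `G ∩ H` where `H` is a hemisphere containing `C`. -/
def HasWidth {d : ℕ} (C : Set (Sph d)) (g : Sph d) (w : ℝ) : Prop :=
  IsLeast {t : ℝ | ∃ h : Sph d, C ⊆ hemisphere h ∧ LuneHasThickness g h t} w

/-- A convex body of constant width `w`. -/
structure IsConstantWidth {d : ℕ} (C : Set (Sph d)) (w : ℝ) : Prop where
  isConvexBody : IsConvexBody C
  hasWidth : ∀ g : Sph d, Supports g C → HasWidth C g w

end Sph

namespace Sph

open scoped RealInnerProductSpace Topology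
open Filter

variable {d : ℕ}

/-! All conditions are read off inner products: $|ab|\le\delta$ means $\cos\delta\le\langle
a,b\rangle$, with $\cos\delta>0$. A complete set is the intersection of the $\delta$-balls about its
own points, which makes it a convex body; compactness gives each boundary point a partner at
distance $\delta$. Conversely, `IsConstantDiameter.isComplete` rests on strict convexity of
$\delta$-balls: an addable outside point, joined to an interior point, would put a boundary point
strictly within $\delta$ of all of $K$.

For width, a lune with centers $g,h$ has thickness $t$ with $\cos t=-\langle g,h\rangle$, so the
width at $g$ is governed by the minimum of $\langle g,\cdot\rangle$ on the polar set
(`hasWidth_iff`). If $g$ supports a complete $K$ at $p$, then $y=\cos\delta\,p+\sin\delta\,g$ lies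
in $K$ (`IsComplete.rotate_mem`). The hemisphere touching the $\delta$-ball about $p$ at $y$
contains $K$ and realizes width $\delta$; a thinner lune would exclude $p$ or $y$.

Conversely, let the width be constant. A farthest pair of $C$ fixes the diameter as $\delta$
(`IsConstantWidth.exists_inner_eq_cos`). If $g$ supports $C$ at $p$ and $h$ minimizes $\langle
g,\cdot\rangle$ on the polar set, the first-order condition and the bipolar theorem put the center
of the facet on $\mathrm{bd}(H)$ into $C$, and it is at distance $\delta$ from $p$. -/

theorem inner_self_eq_one (a : Sph d) : ⟪a.1, a.1⟫ = 1 := by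
  rw [real_inner_self_eq_norm_sq, norm_eq_of_mem_sphere, one_pow]

theorem inner_le_one (a b : Sph d) : ⟪a.1, b.1⟫ ≤ 1 := by
  simpa using real_inner_le_norm a.1 b.1

theorem eq_of_inner_eq_one {a b : Sph d} (h : ⟪a.1, b.1⟫ = 1) : a = b :=
  Subtype.ext ((inner_eq_one_iff_of_norm_eq_one (by simp) (by simp)).1 h)

theorem cos_sdist (a b : Sph d) : Real.cos (sdist a b) = ⟪a.1, b.1⟫ := by
  rw [sdist, InnerProductGeometry.cos_angle]
  simp

theorem sdist_nonneg (a b : Sph d) : 0 ≤ sdist a b := InnerProductGeometry.angle_nonneg _ _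

theorem sdist_le_pi (a b : Sph d) : sdist a b ≤ Real.pi := InnerProductGeometry.angle_le_pi _ _

theorem sdist_le_iff {a b : Sph d} {t : ℝ} (h₀ : 0 ≤ t) (h₁ : t ≤ Real.pi) :
    sdist a b ≤ t ↔ Real.cos t ≤ ⟪a.1, b.1⟫ := by
  rw [← cos_sdist, Real.strictAntiOn_cos.le_iff_ge ⟨h₀, h₁⟩ ⟨sdist_nonneg a b, sdist_le_pi a b⟩]

theorem sdist_eq_iff {a b : Sph d} {t : ℝ} (h₀ : 0 ≤ t) (h₁ : t ≤ Real.pi) :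
    sdist a b = t ↔ ⟪a.1, b.1⟫ = Real.cos t := by
  rw [← cos_sdist]
  exact ⟨fun h => h ▸ rfl, fun h =>
    Real.injOn_cos ⟨sdist_nonneg a b, sdist_le_pi a b⟩ ⟨h₀, h₁⟩ h⟩

theorem mem_hemisphere {c x : Sph d} : x ∈ hemisphere c ↔ 0 ≤ ⟪c.1, x.1⟫ := by
  rw [hemisphere, Set.mem_ofPred_eq, sdist_le_iff (by positivity) (by linarith [Real.pi_pos]),
    Real.cos_pi_div_two]

theorem sdist_le_diam {A : Set (Sph d)} {a b : Sph d} (ha : a ∈ A) (hb : b ∈ A) :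
    sdist a b ≤ diam A := by
  refine le_csSup ⟨Real.pi, ?_⟩ ⟨a, ha, b, hb, rfl⟩
  rintro _ ⟨a, _, b, _, rfl⟩
  exact sdist_le_pi a b

theorem diam_le {A : Set (Sph d)} {t : ℝ} (ht : 0 ≤ t)
    (h : ∀ a ∈ A, ∀ b ∈ A, sdist a b ≤ t) : diam A ≤ t := by
  refine Real.sSup_le ?_ ht
  rintro _ ⟨a, ha, b, hb, rfl⟩
  exact h a ha b hb

/-! ### Radial projection, interiors and hemispheres -/

/-- The radial projection of a nonzero vector to the sphere. -/
noncomputable def normalize (v : EuclideanSpace ℝ (Fin (d + 1))) (hv : v ≠ 0) : Sph d :=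
  ⟨‖v‖⁻¹ • v, by simp [norm_smul, hv]⟩

theorem coe_normalize (v : EuclideanSpace ℝ (Fin (d + 1))) (hv : v ≠ 0) :
    (normalize v hv).1 = ‖v‖⁻¹ • v := rfl

theorem inner_normalize (x v : EuclideanSpace ℝ (Fin (d + 1))) (hv : v ≠ 0) :
    ⟪x, (normalize v hv).1⟫ = ‖v‖⁻¹ * ⟪x, v⟫ := by
  rw [coe_normalize, real_inner_smul_right]

theorem le_inner_normalize_iff {x v : EuclideanSpace ℝ (Fin (d + 1))} (hv : v ≠ 0) {t : ℝ} :
    t ≤ ⟪x, (normalize v hv).1⟫ ↔ t * ‖v‖ ≤ ⟪x, v⟫ := by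
  rw [inner_normalize, ← div_eq_inv_mul, le_div_iff₀ (norm_pos_iff.2 hv)]

theorem inner_normalize_nonneg_iff {x v : EuclideanSpace ℝ (Fin (d + 1))} (hv : v ≠ 0) :
    0 ≤ ⟪x, (normalize v hv).1⟫ ↔ 0 ≤ ⟪x, v⟫ := by
  rw [le_inner_normalize_iff, zero_mul]

theorem IsConvex.normalize_mem {C : Set (Sph d)} (hC : IsConvex C) {a b : Sph d} (ha : a ∈ C)
    (hb : b ∈ C) {s t : ℝ} (hs : 0 ≤ s) (ht : 0 ≤ t) (hv : s • a.1 + t • b.1 ≠ 0) :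
    normalize (s • a.1 + t • b.1) hv ∈ C := by
  refine (hC a ha b hb).2 ⟨‖s • a.1 + t • b.1‖⁻¹ * s, ‖s • a.1 + t • b.1‖⁻¹ * t,
    by positivity, by positivity, ?_⟩
  rw [coe_normalize, smul_add, smul_smul, smul_smul]

/-- Replaces neighbourhoods by a small push in an arbitrary ambient direction, so that a point is
shown not to be interior by one bad direction. -/
theorem exists_normalize_mem_of_mem_interior {C : Set (Sph d)} {x : Sph d} (hx : x ∈ interior C)
    (v : EuclideanSpace ℝ (Fin (d + 1))) :
    ∃ ε : ℝ, 0 < ε ∧ ∃ hv : x.1 + ε • v ≠ 0, normalize (x.1 + ε • v) hv ∈ C := by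
  obtain ⟨r, hr, hrC⟩ := Metric.mem_nhds_iff.1 (mem_interior_iff_mem_nhds.1 hx)
  have hx0 : x.1 ≠ 0 := ne_zero_of_mem_unit_sphere x
  have h1 : Tendsto (fun ε : ℝ => x.1 + ε • v) (𝓝 0) (𝓝 x.1) := by
    have : Continuous (fun ε : ℝ => x.1 + ε • v) := by fun_prop
    simpa using this.tendsto 0
  have h2 : Tendsto (fun ε : ℝ => ‖x.1 + ε • v‖⁻¹ • (x.1 + ε • v)) (𝓝 0) (𝓝 x.1) := by
    simpa using (h1.norm.inv₀ (by simp)).smul h1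
  have h3 := (h2.eventually (Metric.ball_mem_nhds _ hr)).and (h1.eventually_ne hx0)
  obtain ⟨ε, ⟨h4, h5⟩, hε⟩ :=
    ((h3.filter_mono nhdsWithin_le_nhds).and (self_mem_nhdsWithin (s := Set.Ioi (0 : ℝ)))).exists
  exact ⟨ε, hε, h5, hrC h4⟩

theorem inner_pos_of_mem_interior {C : Set (Sph d)} {g x : Sph d} (hg : C ⊆ hemisphere g)
    (hx : x ∈ interior C) : 0 < ⟪g.1, x.1⟫ := by
  obtain ⟨ε, hε, hv, h⟩ := exists_normalize_mem_of_mem_interior hx (-g.1)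
  have := (inner_normalize_nonneg_iff hv).1 (mem_hemisphere.1 (hg h))
  rw [inner_add_right, real_inner_smul_right, inner_neg_right, inner_self_eq_one] at this
  linarith

/-- If a strict inequality between inner products holds at `p` against every point of a compact
set, then it holds near `p`. -/
theorem eventually_forall_lt_inner {K : Set (Sph d)} (hK : IsClosed K) {p : Sph d} {t : ℝ}
    (h : ∀ k ∈ K, t < ⟪k.1, p.1⟫) : ∀ᶠ q in 𝓝 p, ∀ k ∈ K, t < ⟪k.1, q.1⟫ := by
  refine hK.isCompact.eventually_forall_of_forall_eventually fun k hk => ?_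
  have : Continuous fun z : Sph d × Sph d => ⟪z.2.1, z.1.1⟫ := by fun_prop
  exact this.continuousAt.eventually (lt_mem_nhds (h k hk))

theorem isClosed_hemisphere (c : Sph d) : IsClosed (hemisphere c) := by
  have : hemisphere c = {x | 0 ≤ ⟪c.1, x.1⟫} := Set.ext fun _ => mem_hemisphere
  rw [this]
  exact isClosed_le continuous_const (by fun_prop)

theorem mem_frontier_hemisphere {c x : Sph d} :
    x ∈ frontier (hemisphere c) ↔ ⟪c.1, x.1⟫ = 0 := by
  rw [(isClosed_hemisphere c).frontier_eq, Set.mem_sdiff, mem_hemisphere]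
  constructor
  · rintro ⟨h1, h2⟩
    refine le_antisymm (not_lt.1 fun h3 => h2 ?_) h1
    rw [mem_interior_iff_mem_nhds]
    have := eventually_forall_lt_inner (isClosed_singleton (x := c)) (p := x) (t := 0)
      (by simpa using h3)
    filter_upwards [this] with q hq
    exact mem_hemisphere.2 (hq c rfl).le
  · intro h
    exact ⟨h.ge, fun h2 => (inner_pos_of_mem_interior subset_rfl h2).ne' h⟩

theorem mem_frontier_of_inner_eq_zero {C : Set (Sph d)} {g x : Sph d} (hg : C ⊆ hemisphere g)
    (hx : x ∈ C) (h : ⟪g.1, x.1⟫ = 0) : x ∈ frontier C :=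
  ⟨subset_closure hx, fun h2 => (inner_pos_of_mem_interior hg h2).ne' h⟩

/-! ### Complete sets have constant diameter -/

theorem cos_le_inner_of_diam {K : Set (Sph d)} {δ : ℝ} (hδ₀ : 0 ≤ δ) (hδ₁ : δ ≤ Real.pi)
    (hK : diam K = δ) {a b : Sph d} (ha : a ∈ K) (hb : b ∈ K) : Real.cos δ ≤ ⟪a.1, b.1⟫ :=
  (sdist_le_iff hδ₀ hδ₁).1 (hK ▸ sdist_le_diam ha hb)

theorem exists_ne_of_diam_pos {K : Set (Sph d)} (h : 0 < diam K) :
    ∃ a ∈ K, ∃ b ∈ K, a ≠ b := by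
  by_contra! hc
  refine h.not_ge (diam_le le_rfl fun a ha b hb => ?_)
  rw [hc a ha b hb, sdist_le_iff le_rfl Real.pi_pos.le, inner_self_eq_one, Real.cos_zero]

/-- The working form of completeness: adding such a point would not increase the diameter. -/
theorem IsComplete.mem_of_forall_cos_le {K : Set (Sph d)} {δ : ℝ} (hδ₀ : 0 ≤ δ) (hδ₁ : δ ≤ Real.pi)
    (hK : IsComplete K δ) {x : Sph d} (hx : ∀ k ∈ K, Real.cos δ ≤ ⟪k.1, x.1⟫) : x ∈ K := by
  by_contra hxK
  refine (hK.lt_diam_insert x hxK).not_ge (diam_le hδ₀ ?_)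
  have hself : sdist x x ≤ δ := by
    rw [sdist_le_iff hδ₀ hδ₁, inner_self_eq_one]
    exact Real.cos_le_one δ
  rintro a (ha | rfl) b (hb | rfl)
  · exact (sdist_le_iff hδ₀ hδ₁).2 (cos_le_inner_of_diam hδ₀ hδ₁ hK.diam_eq ha hb)
  · exact (sdist_le_iff hδ₀ hδ₁).2 (hx a ha)
  · exact (sdist_le_iff hδ₀ hδ₁).2 (real_inner_comm a.1 b.1 ▸ hx b hb)
  · exact hself

theorem IsComplete.isClosed {K : Set (Sph d)} {δ : ℝ} (hδ₀ : 0 ≤ δ) (hδ₁ : δ ≤ Real.pi)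
    (hK : IsComplete K δ) : IsClosed K := by
  have : K = ⋂ k ∈ K, {x | Real.cos δ ≤ ⟪k.1, x.1⟫} := by
    refine Set.Subset.antisymm (fun x hx => ?_) fun x hx => ?_
    · exact Set.mem_iInter₂.2 fun k hk => cos_le_inner_of_diam hδ₀ hδ₁ hK.diam_eq hk hx
    · exact hK.mem_of_forall_cos_le hδ₀ hδ₁ fun k hk => Set.mem_iInter₂.1 hx k hk
  rw [this]
  exact isClosed_biInter fun k _ => isClosed_le continuous_const (by fun_prop)

theorem one_le_add_of_eq {a b x : Sph d} {s t : ℝ} (hs : 0 ≤ s) (ht : 0 ≤ t)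
    (hx : x.1 = s • a.1 + t • b.1) : 1 ≤ s + t := by
  have h : ⟪x.1, x.1⟫ = s * ⟪x.1, a.1⟫ + t * ⟪x.1, b.1⟫ := by
    nth_rw 2 [hx]
    rw [inner_add_right, real_inner_smul_right, real_inner_smul_right]
  rw [inner_self_eq_one] at h
  have := mul_le_mul_of_nonneg_left (inner_le_one x a) hs
  have := mul_le_mul_of_nonneg_left (inner_le_one x b) ht
  linarith

theorem IsComplete.isConvex {K : Set (Sph d)} {δ : ℝ} (hδ₀ : 0 ≤ δ) (hδ₁ : δ < Real.pi / 2)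
    (hK : IsComplete K δ) : IsConvex K := by
  have hπ : δ ≤ Real.pi := by linarith [Real.pi_pos]
  have hcos : 0 < Real.cos δ := Real.cos_pos_of_mem_Ioo ⟨by linarith [Real.pi_pos], hδ₁⟩
  refine fun a ha b hb => ⟨?_, ?_⟩
  · rintro rfl
    have := cos_le_inner_of_diam hδ₀ hπ hK.diam_eq ha hb
    have h2 : ⟪a.1, (-a).1⟫ = -1 := by
      rw [coe_neg_sphere, inner_neg_right, inner_self_eq_one]
    linarith
  · rintro x ⟨s, t, hs, ht, hx⟩
    refine hK.mem_of_forall_cos_le hδ₀ hπ fun k hk => ?_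
    -- Coefficients of a point of the arc sum to at least 1, and $\cos\delta\ge 0$, so a common
    -- lower bound $\cos\delta$ at the endpoints survives on the arc.
    have h1 := one_le_add_of_eq hs ht hx
    rw [hx, inner_add_right, real_inner_smul_right, real_inner_smul_right]
    have h2 := cos_le_inner_of_diam hδ₀ hπ hK.diam_eq hk ha
    have h3 := cos_le_inner_of_diam hδ₀ hπ hK.diam_eq hk hb
    nlinarith

theorem IsComplete.nonempty_interior {K : Set (Sph d)} {δ : ℝ} (hδ₀ : 0 < δ)
    (hδ₁ : δ < Real.pi / 2) (hK : IsComplete K δ) : (interior K).Nonempty := by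
  have hπ : δ ≤ Real.pi := by linarith [Real.pi_pos]
  have hcos : 0 < Real.cos δ := Real.cos_pos_of_mem_Ioo ⟨by linarith [Real.pi_pos], hδ₁⟩
  obtain ⟨a, ha, b, hb, hab⟩ := exists_ne_of_diam_pos (hK.diam_eq ▸ hδ₀)
  have hlt : ⟪a.1, b.1⟫ < 1 :=
    lt_of_le_of_ne (inner_le_one a b) fun h => hab (eq_of_inner_eq_one h)
  have hnorm : ‖a.1 + b.1‖ < 2 := by
    have : ‖a.1 + b.1‖ ^ 2 < 2 ^ 2 := by
      rw [norm_add_sq_real, norm_eq_of_mem_sphere, norm_eq_of_mem_sphere]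
      linarith
    exact lt_of_pow_lt_pow_left₀ 2 (by norm_num) this
  have hle : ∀ k ∈ K, 2 * Real.cos δ ≤ ⟪k.1, a.1 + b.1⟫ := fun k hk => by
    rw [inner_add_right]
    linarith [cos_le_inner_of_diam hδ₀.le hπ hK.diam_eq hk ha,
      cos_le_inner_of_diam hδ₀.le hπ hK.diam_eq hk hb]
  have hv : a.1 + b.1 ≠ 0 := by
    intro h
    have := hle a ha
    rw [h, inner_zero_right] at this
    linarith
  -- The midpoint of two distinct points: dividing by $\|a+b\|<2$ makes every distance bound strict.
  refine ⟨normalize _ hv, mem_interior_iff_mem_nhds.2 ?_⟩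
  have key : ∀ k ∈ K, Real.cos δ < ⟪k.1, (normalize _ hv).1⟫ := fun k hk => by
    rw [inner_normalize, ← div_eq_inv_mul, lt_div_iff₀ (norm_pos_iff.2 hv)]
    nlinarith [hle k hk]
  filter_upwards [eventually_forall_lt_inner (hK.isClosed hδ₀.le hπ) key] with q hq
  exact hK.mem_of_forall_cos_le hδ₀.le hπ fun k hk => (hq k hk).le

theorem IsComplete.isConstantDiameter {K : Set (Sph d)} {δ : ℝ} (hδ₀ : 0 < δ)
    (hδ₁ : δ < Real.pi / 2) (hK : IsComplete K δ) : IsConstantDiameter K δ := by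
  have hπ : δ ≤ Real.pi := by linarith [Real.pi_pos]
  have hcos : 0 < Real.cos δ := Real.cos_pos_of_mem_Ioo ⟨by linarith [Real.pi_pos], hδ₁⟩
  have hsin : 0 < Real.sin δ := Real.sin_pos_of_pos_of_lt_pi hδ₀ (by linarith [Real.pi_pos])
  have hcl := hK.isClosed hδ₀.le hπ
  refine ⟨⟨hcl, hK.isConvex hδ₀.le hδ₁, hK.nonempty_interior hδ₀ hδ₁⟩, hK.diam_eq, ?_⟩
  intro p hp
  have hpK : p ∈ K := hcl.frontier_subset hp
  obtain ⟨q, hqK, hq⟩ : ∃ q ∈ K, ⟪q.1, p.1⟫ ≤ Real.cos δ := by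
    by_contra! hc
    refine hp.2 (mem_interior_iff_mem_nhds.2 ?_)
    filter_upwards [eventually_forall_lt_inner hcl hc] with x hx
    exact hK.mem_of_forall_cos_le hδ₀.le hπ fun k hk => (hx k hk).le
  have hpq : ⟪p.1, q.1⟫ = Real.cos δ :=
    le_antisymm (real_inner_comm q.1 p.1 ▸ hq) (cos_le_inner_of_diam hδ₀.le hπ hK.diam_eq hpK hqK)
  refine ⟨q, ⟨subset_closure hqK, fun hqi => ?_⟩, (sdist_eq_iff hδ₀.le hπ).2 hpq⟩
  -- The direction is tangent at $q$ and points away from $p$; moving along it leaves the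
  -- $\delta$-ball about $p$.
  obtain ⟨ε, hε, hv, h⟩ := exists_normalize_mem_of_mem_interior hqi
    (Real.cos δ • q.1 - p.1)
  have h1 := (le_inner_normalize_iff hv).1 (cos_le_inner_of_diam hδ₀.le hπ hK.diam_eq hpK h)
  have h2 : 1 ≤ ‖q.1 + ε • (Real.cos δ • q.1 - p.1)‖ := by
    have h3 : ⟪q.1, q.1 + ε • (Real.cos δ • q.1 - p.1)⟫ = 1 := by
      rw [inner_add_right, real_inner_smul_right, inner_sub_right, real_inner_smul_right,
        inner_self_eq_one, real_inner_comm, hpq]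
      ring
    have h4 := real_inner_le_norm q.1 (q.1 + ε • (Real.cos δ • q.1 - p.1))
    rw [h3, norm_eq_of_mem_sphere, one_mul] at h4
    exact h4
  rw [inner_add_right, real_inner_smul_right, inner_sub_right, real_inner_smul_right,
    inner_self_eq_one, hpq] at h1
  have h5 : 0 < ε * (1 - Real.cos δ * Real.cos δ) := by
    have := Real.sin_sq_add_cos_sq δ
    have : 1 - Real.cos δ * Real.cos δ = Real.sin δ ^ 2 := by linarith
    rw [this]
    positivity
  nlinarith

/-! ### Bodies of constant diameter are complete -/

theorem exists_arc_mem_frontier {C : Set (Sph d)} {q x : Sph d} (hq : q ∈ C) (hx : x ∉ C)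
    (hqx : x ≠ -q) : (arc q x ∩ frontier C).Nonempty := by
  have hne : ∀ l : unitInterval, (1 - l.1) • q.1 + l.1 • x.1 ≠ 0 := by
    rintro ⟨l, hl₀, hl₁⟩ h
    have h1 : (1 - l) • q.1 = -(l • x.1) := eq_neg_of_add_eq_zero_left h
    have h2 := congrArg norm h1
    rw [norm_neg, norm_smul, norm_smul, norm_eq_of_mem_sphere, norm_eq_of_mem_sphere,
      Real.norm_of_nonneg hl₀, Real.norm_of_nonneg (sub_nonneg.2 hl₁)] at h2
    have h3 : l = 1 / 2 := by linarith
    subst h3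
    refine hqx (Subtype.ext ?_)
    rw [coe_neg_sphere, eq_neg_iff_add_eq_zero]
    have h4 : (1 / 2 : ℝ) • (x.1 + q.1) = (1 - 1 / 2 : ℝ) • q.1 + (1 / 2 : ℝ) • x.1 := by module
    exact (smul_eq_zero.1 (h4.trans h)).resolve_left (by norm_num)
  let f : unitInterval → Sph d := fun l => normalize _ (hne l)
  have hf : Continuous f := by
    refine Continuous.subtype_mk ?_ _
    have h : Continuous fun l : unitInterval => (1 - l.1) • q.1 + l.1 • x.1 := by fun_prop
    exact (h.norm.inv₀ fun l => norm_ne_zero_iff.2 (hne l)).smul h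
  have hf0 : f 0 = q := Subtype.ext (by simp [f, coe_normalize])
  have hf1 : f 1 = x := Subtype.ext (by simp [f, coe_normalize])
  obtain ⟨l, hl⟩ := nonempty_frontier_iff.2
    (⟨⟨0, show f 0 ∈ C from hf0 ▸ hq⟩, fun h =>
      hx (hf1 ▸ show f 1 ∈ C from h.ge (Set.mem_univ 1))⟩ : (f ⁻¹' C).Nonempty ∧ f ⁻¹' C ≠ Set.univ)
  replace hl := hf.frontier_preimage_subset C hl
  have hi : 0 ≤ ‖(1 - l.1) • q.1 + l.1 • x.1‖⁻¹ := by positivity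
  refine ⟨f l, ⟨_, _, mul_nonneg hi (sub_nonneg.2 l.2.2), mul_nonneg hi l.2.1, ?_⟩, hl⟩
  rw [coe_normalize, smul_add, smul_smul, smul_smul]

theorem IsConstantDiameter.isComplete {K : Set (Sph d)} {δ : ℝ} (hδ₀ : 0 < δ)
    (hδ₁ : δ < Real.pi / 2) (hK : IsConstantDiameter K δ) : IsComplete K δ := by
  have hπ : δ ≤ Real.pi := by linarith [Real.pi_pos]
  have hcos : 0 < Real.cos δ := Real.cos_pos_of_mem_Ioo ⟨by linarith [Real.pi_pos], hδ₁⟩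
  have hcl := hK.isConvexBody.isClosed
  obtain ⟨q, hq⟩ := hK.isConvexBody.nonempty_interior
  have hqK := interior_subset hq
  refine ⟨⟨q, fun k hk => mem_hemisphere.2 ?_⟩, hK.diam_eq, fun x hx => ?_⟩
  · exact hcos.le.trans (cos_le_inner_of_diam hδ₀.le hπ hK.diam_eq hqK hk)
  by_contra! hd
  have hle : ∀ k ∈ K, Real.cos δ ≤ ⟪k.1, x.1⟫ := fun k hk =>
    (sdist_le_iff hδ₀.le hπ).1 ((sdist_le_diam (Or.inl hk) (Or.inr rfl)).trans hd)
  have hqx : x ≠ -q := by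
    rintro rfl
    have := hle q hqK
    rw [coe_neg_sphere, inner_neg_right, inner_self_eq_one] at this
    linarith
  have hlt : ⟪q.1, x.1⟫ < 1 :=
    lt_of_le_of_ne (inner_le_one q x) fun h => hx (eq_of_inner_eq_one h ▸ hqK)
  obtain ⟨p, ⟨s, t, hs, ht, hp⟩, hpf⟩ := exists_arc_mem_frontier hqK hx hqx
  obtain ⟨p', hp', hpp'⟩ := hK.exists_sdist_eq p hpf
  have hp'K := hcl.frontier_subset hp'
  -- Both $q$ and $x$ are within $\delta$ of $p'$, so $\cos\delta=\langle
  -- p',p\rangle\ge(s+t)\cos\delta$. A unit vector on the chord from $q$ to $x$ must then be an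
  -- endpoint.
  have hst : s + t = 1 := by
    refine le_antisymm ?_ (one_le_add_of_eq hs ht hp)
    have h1 := (sdist_eq_iff hδ₀.le hπ).1 hpp'
    rw [real_inner_comm, hp, inner_add_right, real_inner_smul_right, real_inner_smul_right] at h1
    have h2 := mul_le_mul_of_nonneg_left (hle p' hp'K) ht
    have h3 := mul_le_mul_of_nonneg_left
      (cos_le_inner_of_diam hδ₀.le hπ hK.diam_eq hp'K hqK) hs
    nlinarith
  have h1 : s * s + 2 * (s * t * ⟪q.1, x.1⟫) + t * t = 1 := by
    have := inner_self_eq_one p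
    rw [hp, inner_add_left, inner_add_right, inner_add_right] at this
    simp only [real_inner_smul_left, real_inner_smul_right, inner_self_eq_one,
      real_inner_comm q.1 x.1] at this
    linarith
  have h2 : s * t * (1 - ⟪q.1, x.1⟫) = 0 := by
    have : s = 1 - t := by linarith
    subst this
    linarith
  rcases mul_eq_zero.1 h2 with h3 | h3
  · rcases mul_eq_zero.1 h3 with rfl | rfl
    · have ht1 : t = 1 := by linarith
      have : p = x := Subtype.ext (by simp [hp, ht1])
      exact hx (this ▸ hcl.frontier_subset hpf)
    · have hs1 : s = 1 := by linarith
      have : p = q := Subtype.ext (by simp [hp, hs1])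
      exact hpf.2 (this ▸ hq)
  · linarith

/-! ### Lunes and their thickness -/

theorem inner_sq_add_inner_sq_le_one {a b : Sph d} (hab : ⟪a.1, b.1⟫ = 0) (x : Sph d) :
    ⟪a.1, x.1⟫ ^ 2 + ⟪b.1, x.1⟫ ^ 2 ≤ 1 := by
  have h := real_inner_self_nonneg (x := x.1 - ⟪a.1, x.1⟫ • a.1 - ⟪b.1, x.1⟫ • b.1)
  simp only [inner_sub_left, inner_sub_right, real_inner_smul_left, real_inner_smul_right,
    inner_self_eq_one, real_inner_comm a.1 x.1, real_inner_comm b.1 x.1, real_inner_comm a.1 b.1,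
    hab] at h
  nlinarith

theorem abs_inner_lt_one {a b : Sph d} (h : a ≠ b) (h' : a ≠ -b) : |⟪a.1, b.1⟫| < 1 := by
  refine abs_lt.2 ⟨lt_of_le_of_ne ?_ fun h1 => h' ?_,
    lt_of_le_of_ne (inner_le_one a b) fun h1 => h (eq_of_inner_eq_one h1)⟩
  · have := inner_le_one a (-b)
    rw [coe_neg_sphere, inner_neg_right] at this
    linarith
  · refine eq_of_inner_eq_one ?_
    rw [coe_neg_sphere, inner_neg_right, ← h1, neg_neg]

theorem one_sub_inner_sq_pos {a b : Sph d} (h : a ≠ b) (h' : a ≠ -b) :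
    0 < 1 - ⟪a.1, b.1⟫ ^ 2 := by
  have := (sq_lt_one_iff_abs_lt_one _).2 (abs_inner_lt_one h h')
  linarith

theorem isFacetCenter_iff {g h c : Sph d} : IsFacetCenter g h c ↔ ⟪g.1, c.1⟫ = 0 ∧
    ∀ x : Sph d, ⟪g.1, x.1⟫ = 0 → (0 ≤ ⟪h.1, x.1⟫ ↔ 0 ≤ ⟪c.1, x.1⟫) := by
  rw [IsFacetCenter, mem_frontier_hemisphere, Set.ext_iff]
  refine and_congr_right fun _ => forall_congr' fun x => ?_
  have h1 : sdist c x ≤ Real.pi / 2 ↔ 0 ≤ ⟪c.1, x.1⟫ := mem_hemisphere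
  rw [Set.mem_inter_iff, Set.mem_ofPred_eq, mem_frontier_hemisphere, mem_hemisphere, h1,
    and_congr_right_iff]

theorem IsFacetCenter.eq_add {g h c : Sph d} (hc : IsFacetCenter g h c) :
    h.1 = ⟪g.1, h.1⟫ • g.1 + ⟪h.1, c.1⟫ • c.1 ∧ 0 ≤ ⟪h.1, c.1⟫ := by
  obtain ⟨hgc, hx⟩ := isFacetCenter_iff.1 hc
  have key : ∀ v : EuclideanSpace ℝ (Fin (d + 1)), ⟪g.1, v⟫ = 0 → 0 ≤ ⟪c.1, v⟫ → 0 ≤ ⟪h.1, v⟫ := by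
    intro v hgv hcv
    rcases eq_or_ne v 0 with rfl | hv
    · simp
    · have := hx (normalize v hv) (by rw [inner_normalize, hgv, mul_zero])
      rw [inner_normalize_nonneg_iff, inner_normalize_nonneg_iff] at this
      exact this.2 hcv
  refine ⟨?_, key _ hgc (by rw [inner_self_eq_one]; norm_num)⟩
  -- The remainder is orthogonal to $g$ and $c$, so `key` applies to both $v$ and $-v$. This gives
  -- $v\perp h$, hence $v\perp v$.
  set v := h.1 - ⟪g.1, h.1⟫ • g.1 - ⟪h.1, c.1⟫ • c.1 with hv
  have hgv : ⟪g.1, v⟫ = 0 := by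
    rw [hv, inner_sub_right, inner_sub_right, real_inner_smul_right, real_inner_smul_right,
      inner_self_eq_one, hgc]
    ring
  have hcv : ⟪c.1, v⟫ = 0 := by
    rw [hv, inner_sub_right, inner_sub_right, real_inner_smul_right, real_inner_smul_right,
      inner_self_eq_one, real_inner_comm g.1 c.1, hgc, real_inner_comm h.1 c.1]
    ring
  have hhv : ⟪h.1, v⟫ = 0 := by
    refine le_antisymm ?_ (key v hgv hcv.ge)
    have := key (-v) (by rw [inner_neg_right, hgv, neg_zero])
      (by rw [inner_neg_right, hcv, neg_zero])
    rw [inner_neg_right] at this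
    linarith
  have hvv : ⟪v, v⟫ = 0 := by
    nth_rw 1 [hv]
    rw [inner_sub_left, inner_sub_left, real_inner_smul_left, real_inner_smul_left, hgv, hcv, hhv]
    ring
  have := inner_self_eq_zero.1 hvv
  rw [hv, sub_sub, sub_eq_zero] at this
  exact this

theorem exists_isFacetCenter {g h : Sph d} (h₁ : g ≠ h) (h₂ : g ≠ -h) :
    ∃ c, IsFacetCenter g h c := by
  have hpos := one_sub_inner_sq_pos h₁ h₂
  have hv : h.1 - ⟪g.1, h.1⟫ • g.1 ≠ 0 := by
    intro h0
    have : ⟪h.1, h.1 - ⟪g.1, h.1⟫ • g.1⟫ = 0 := by rw [h0, inner_zero_right]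
    rw [inner_sub_right, real_inner_smul_right, inner_self_eq_one, real_inner_comm g.1 h.1] at this
    nlinarith
  refine ⟨normalize _ hv, isFacetCenter_iff.2 ⟨?_, fun x hx => ?_⟩⟩
  · rw [inner_normalize, inner_sub_right, real_inner_smul_right, inner_self_eq_one]
    ring
  · rw [real_inner_comm, real_inner_comm x.1 (normalize _ hv).1, inner_normalize_nonneg_iff,
      inner_sub_right, real_inner_smul_right, real_inner_comm g.1 x.1, hx, mul_zero, sub_zero]

/-- With $u=\langle g,h\rangle$, one has $h=ug+kc$ and $g=uh+kc'$ for the same $k=\sqrt{1-u^2}>0$.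
Expanding $\langle h,c'\rangle=0$ gives $\langle c,c'\rangle=-u$. -/
theorem LuneHasThickness.cos_eq {g h : Sph d} {t : ℝ} (ht : LuneHasThickness g h t) :
    Real.cos t = -⟪g.1, h.1⟫ := by
  obtain ⟨h₁, h₂, c, c', hc, hc', rfl⟩ := ht
  have hpos := one_sub_inner_sq_pos h₁ h₂
  obtain ⟨e1, k1⟩ := hc.eq_add
  obtain ⟨e2, k2⟩ := hc'.eq_add
  have hgc := (isFacetCenter_iff.1 hc).1
  have hhc := (isFacetCenter_iff.1 hc').1
  rw [real_inner_comm g.1 h.1] at e2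
  set u := ⟪g.1, h.1⟫ with hu
  set k := ⟪h.1, c.1⟫ with hk
  set k' := ⟪g.1, c'.1⟫ with hk'
  have f1 : k ^ 2 = 1 - u ^ 2 := by
    have := inner_self_eq_one h
    nth_rw 1 [e1] at this
    rw [inner_add_left, real_inner_smul_left, real_inner_smul_left, ← hu, real_inner_comm h.1 c.1,
      ← hk] at this
    linarith
  have f2 : k' ^ 2 = 1 - u ^ 2 := by
    have := inner_self_eq_one g
    nth_rw 1 [e2] at this
    rw [inner_add_left, real_inner_smul_left, real_inner_smul_left, real_inner_comm g.1 h.1, ← hu,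
      real_inner_comm g.1 c'.1, ← hk'] at this
    linarith
  have f3 : k = k' := by
    rw [← Real.sqrt_sq k1, ← Real.sqrt_sq k2, f1, f2]
  have f4 : u * k' + k * ⟪c.1, c'.1⟫ = 0 := by
    have := hhc
    rw [e1, inner_add_left, real_inner_smul_left, real_inner_smul_left] at this
    exact this
  rw [cos_sdist]
  have hk0 : k ≠ 0 := by
    intro h0
    rw [h0] at f1
    linarith
  rw [← f3] at f4
  have : k * (u + ⟪c.1, c'.1⟫) = 0 := by linarith
  have := (mul_eq_zero.1 this).resolve_left hk0
  linarith

theorem LuneHasThickness.mem_Icc {g h : Sph d} {t : ℝ} (ht : LuneHasThickness g h t) :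
    t ∈ Set.Icc 0 Real.pi := by
  obtain ⟨_, _, c, c', _, _, rfl⟩ := ht
  exact ⟨sdist_nonneg c c', sdist_le_pi c c'⟩

theorem luneHasThickness_iff {g h : Sph d} {t : ℝ} (h₀ : 0 ≤ t) (h₁ : t ≤ Real.pi) :
    LuneHasThickness g h t ↔ g ≠ h ∧ g ≠ -h ∧ ⟪g.1, h.1⟫ = -Real.cos t := by
  refine ⟨fun ht => ⟨ht.1, ht.2.1, by rw [ht.cos_eq, neg_neg]⟩, fun ⟨h2, h3, h4⟩ => ?_⟩
  obtain ⟨c, hc⟩ := exists_isFacetCenter h2 h3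
  obtain ⟨c', hc'⟩ := exists_isFacetCenter h2.symm fun h => h3 (by rw [h, neg_neg])
  have ht : LuneHasThickness g h (sdist c c') := ⟨h2, h3, c, c', hc, hc', rfl⟩
  have h5 := ht.cos_eq
  rw [h4, neg_neg] at h5
  rwa [Real.injOn_cos ht.mem_Icc ⟨h₀, h₁⟩ h5] at ht

/-! ### Polar sets, width and the bipolar theorem -/

/-- The polar set: the centers of the hemispheres that contain `C`. -/
def polar (C : Set (Sph d)) : Set (Sph d) := {h | C ⊆ hemisphere h}

theorem inner_nonneg_of_mem_polar {C : Set (Sph d)} {h x : Sph d} (hh : h ∈ polar C) (hx : x ∈ C) :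
    0 ≤ ⟪h.1, x.1⟫ := mem_hemisphere.1 (hh hx)

theorem mem_polar_iff {C : Set (Sph d)} {h : Sph d} :
    h ∈ polar C ↔ ∀ x ∈ C, 0 ≤ ⟪h.1, x.1⟫ :=
  forall₂_congr fun _ _ => mem_hemisphere

theorem neg_notMem_polar {C : Set (Sph d)} (hC : (interior C).Nonempty) {h : Sph d}
    (hh : h ∈ polar C) : -h ∉ polar C := by
  intro hn
  obtain ⟨x, hx⟩ := hC
  have h1 := inner_pos_of_mem_interior hh hx
  have h2 := inner_pos_of_mem_interior hn hx
  rw [coe_neg_sphere, inner_neg_left] at h2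
  linarith

theorem isConvex_polar {C : Set (Sph d)} (hC : (interior C).Nonempty) : IsConvex (polar C) := by
  refine fun a ha b hb => ⟨fun h => neg_notMem_polar hC ha (h ▸ hb), ?_⟩
  rintro x ⟨s, t, hs, ht, hx⟩
  refine mem_polar_iff.2 fun y hy => ?_
  rw [hx, inner_add_left, real_inner_smul_left, real_inner_smul_left]
  have := inner_nonneg_of_mem_polar ha hy
  have := inner_nonneg_of_mem_polar hb hy
  positivity

theorem isClosed_polar (C : Set (Sph d)) : IsClosed (polar C) := by
  have : polar C = ⋂ x ∈ C, {h | 0 ≤ ⟪h.1, x.1⟫} := by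
    ext h
    simp [mem_polar_iff]
  rw [this]
  exact isClosed_biInter fun x _ => isClosed_le continuous_const (by fun_prop)

theorem supports_iff {g : Sph d} {C : Set (Sph d)} :
    Supports g C ↔ g ∈ polar C ∧ ∃ p ∈ C, ⟪g.1, p.1⟫ = 0 := by
  refine and_congr_right fun _ => exists_congr fun p => ?_
  rw [Set.mem_inter_iff, mem_frontier_hemisphere, and_comm]

/-- The degenerate lunes do no harm: nonempty interior rules out $h=-g$, while $h=g$ has inner
product $1$, which meets the bound and, as $t<\pi$, never attains it. -/
theorem hasWidth_iff {C : Set (Sph d)} (hC : (interior C).Nonempty) {g : Sph d} (hg : g ∈ polar C)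
    {t : ℝ} (h₀ : 0 < t) (h₁ : t < Real.pi) :
    HasWidth C g t ↔ (∃ h ∈ polar C, ⟪g.1, h.1⟫ = -Real.cos t) ∧
      ∀ h ∈ polar C, -Real.cos t ≤ ⟪g.1, h.1⟫ := by
  have hne : ∀ h ∈ polar C, g ≠ -h := fun h hh e => neg_notMem_polar hC hh (e ▸ hg)
  constructor
  · rintro ⟨⟨h, hh, ht⟩, hlb⟩
    refine ⟨⟨h, hh, ((luneHasThickness_iff h₀.le h₁.le).1 ht).2.2⟩, fun k hk => ?_⟩
    rcases eq_or_ne g k with rfl | hgk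
    · rw [inner_self_eq_one]
      linarith [Real.neg_one_le_cos t]
    · have hk1 := abs_le.1 (abs_inner_lt_one hgk (hne k hk)).le
      have := hlb ⟨k, hk, (luneHasThickness_iff (Real.arccos_nonneg (-⟪g.1, k.1⟫))
        (Real.arccos_le_pi _)).2 ⟨hgk, hne k hk,
          by rw [Real.cos_arccos (by linarith) (by linarith), neg_neg]⟩⟩
      have := Real.strictAntiOn_cos.antitoneOn ⟨h₀.le, h₁.le⟩
        ⟨Real.arccos_nonneg _, Real.arccos_le_pi _⟩ this
      rw [Real.cos_arccos (by linarith) (by linarith)] at this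
      linarith
  · rintro ⟨⟨h, hh, ht⟩, hlb⟩
    refine ⟨⟨h, hh, (luneHasThickness_iff h₀.le h₁.le).2 ⟨?_, hne h hh, ht⟩⟩, ?_⟩
    · rintro rfl
      rw [inner_self_eq_one] at ht
      have := Real.strictAntiOn_cos ⟨h₀.le, h₁.le⟩ ⟨Real.pi_pos.le, le_rfl⟩ h₁
      rw [Real.cos_pi] at this
      linarith
    · rintro s ⟨k, hk, hs⟩
      refine (Real.strictAntiOn_cos.le_iff_ge hs.mem_Icc ⟨h₀.le, h₁.le⟩).1 ?_
      rw [hs.cos_eq]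
      linarith [hlb k hk]

/-- The closed convex cone spanned by a nonempty closed convex subset of the sphere. -/
noncomputable def cone {C : Set (Sph d)} (hne : C.Nonempty) (hC : IsConvex C) (hcl : IsClosed C) :
    ProperCone ℝ (EuclideanSpace ℝ (Fin (d + 1))) where
  carrier := {v | ∃ t : ℝ, 0 ≤ t ∧ ∃ c ∈ C, v = t • c.1}
  zero_mem' := ⟨0, le_rfl, hne.some, hne.some_mem, (zero_smul _ _).symm⟩
  add_mem' := by
    rintro _ _ ⟨s, hs, a, ha, rfl⟩ ⟨t, ht, b, hb, rfl⟩
    by_cases hv : s • a.1 + t • b.1 = 0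
    · exact ⟨0, le_rfl, a, ha, by rw [hv, zero_smul]⟩
    · refine ⟨_, norm_nonneg (s • a.1 + t • b.1), _, hC.normalize_mem ha hb hs ht hv, ?_⟩
      rw [coe_normalize, smul_smul, mul_inv_cancel₀ (norm_ne_zero_iff.2 hv), one_smul]
  smul_mem' := by
    rintro r _ ⟨t, ht, c, hc, rfl⟩
    exact ⟨r * t, mul_nonneg r.2 ht, c, hc, smul_smul r.1 t c.1⟩
  isClosed' := by
    have h1 : IsClosed (Subtype.val '' C : Set (EuclideanSpace ℝ (Fin (d + 1)))) :=
      (hcl.isCompact.image continuous_subtype_val).isClosed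
    -- Off the origin, membership in the cone means that $v/\|v\|$ lies in the compact set $C$, so
    -- the complement is open.
    have h2 : ContinuousOn (fun v : EuclideanSpace ℝ (Fin (d + 1)) => ‖v‖⁻¹ • v) {0}ᶜ :=
      (continuousOn_id.norm.inv₀ fun v hv => norm_ne_zero_iff.2 hv).smul continuousOn_id
    have h3 := h2.isOpen_inter_preimage isOpen_compl_singleton h1.isOpen_compl
    rw [← isOpen_compl_iff]
    convert h3 using 1
    ext v
    constructor
    · refine fun h => ⟨?_, ?_⟩
      · rintro rfl
        exact h ⟨0, le_rfl, hne.some, hne.some_mem, (zero_smul _ _).symm⟩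
      · rintro ⟨c, hc, hcv⟩
        refine h ⟨‖v‖, norm_nonneg v, c, hc, ?_⟩
        rcases eq_or_ne v 0 with rfl | hv
        · simp
        · rw [hcv, smul_smul, mul_inv_cancel₀ (norm_ne_zero_iff.2 hv), one_smul]
    · rintro ⟨hv, h⟩ ⟨t, ht, c, hc, rfl⟩
      refine h ⟨c, hc, ?_⟩
      have ht0 : t ≠ 0 := by
        rintro rfl
        exact hv (zero_smul _ _)
      simp [norm_smul, abs_of_nonneg ht, smul_smul, inv_mul_cancel₀ ht0]

theorem mem_of_forall_polar {C : Set (Sph d)} (hne : C.Nonempty) (hC : IsConvex C)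
    (hcl : IsClosed C) {x : Sph d} (hx : ∀ h ∈ polar C, 0 ≤ ⟪h.1, x.1⟫) : x ∈ C := by
  by_contra hxC
  have hxD : x.1 ∉ cone hne hC hcl := by
    rintro ⟨t, ht, c, hc, h⟩
    have h1 := congrArg norm h
    rw [norm_smul, norm_eq_of_mem_sphere, norm_eq_of_mem_sphere, Real.norm_of_nonneg ht,
      mul_one] at h1
    rw [← h1, one_smul] at h
    exact hxC (Subtype.ext h ▸ hc)
  obtain ⟨y, hy, hyx⟩ := (cone hne hC hcl).hyperplane_separation' hxD
  have hy0 : y ≠ 0 := by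
    rintro rfl
    simp at hyx
  have h1 : normalize y hy0 ∈ polar C := mem_polar_iff.2 fun c hc => by
    rw [real_inner_comm, inner_normalize_nonneg_iff]
    exact hy c.1 ⟨1, zero_le_one, c, hc, (one_smul _ _).symm⟩
  have h2 := hx _ h1
  rw [real_inner_comm, inner_normalize_nonneg_iff] at h2
  linarith

/-- Otherwise all polar inequalities are strict at $p$; the polar set is compact, so they persist
nearby, and the bipolar theorem makes $p$ interior. -/
theorem exists_polar_inner_eq_zero {C : Set (Sph d)} (hne : C.Nonempty) (hC : IsConvex C)
    (hcl : IsClosed C) {p : Sph d} (hp : p ∈ frontier C) :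
    ∃ g ∈ polar C, ⟪g.1, p.1⟫ = 0 := by
  have hpC := hcl.frontier_subset hp
  by_contra! hc
  refine hp.2 (mem_interior_iff_mem_nhds.2 ?_)
  have := eventually_forall_lt_inner (isClosed_polar C) (p := p) (t := 0) fun k hk =>
    lt_of_le_of_ne (inner_nonneg_of_mem_polar hk hpC) (hc k hk).symm
  filter_upwards [this] with q hq
  exact mem_of_forall_polar hne hC hcl fun h hh => (hq h hh).le

/-! ### First-order condition and auxiliary points -/

theorem norm_le_half_one_add_sq (w : EuclideanSpace ℝ (Fin (d + 1))) :
    ‖w‖ ≤ (1 + ‖w‖ ^ 2) / 2 := by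
  nlinarith [sq_nonneg (‖w‖ - 1)]

/-- First order condition at a point of a convex set that minimizes a linear form. -/
theorem IsConvex.inner_mul_inner_le {C : Set (Sph d)} (hC : IsConvex C) {v x : Sph d}
    {z : EuclideanSpace ℝ (Fin (d + 1))} (hv : v ∈ C) (hx : x ∈ C)
    (hmin : ∀ y ∈ C, ⟪z, v.1⟫ ≤ ⟪z, y.1⟫) : ⟪z, v.1⟫ * ⟪v.1, x.1⟫ ≤ ⟪z, x.1⟫ := by
  have key : ∀ t : ℝ, 0 < t → ⟪z, v.1⟫ * ‖v.1 + t • x.1‖ ≤ ⟪z, v.1⟫ + t * ⟪z, x.1⟫ := by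
    intro t ht
    have e : v.1 + t • x.1 = (1 : ℝ) • v.1 + t • x.1 := by rw [one_smul]
    rw [← real_inner_smul_right, ← inner_add_right]
    by_cases h0 : v.1 + t • x.1 = 0
    · simp [h0]
    · rw [← le_inner_normalize_iff h0]
      have h1 : (1 : ℝ) • v.1 + t • x.1 ≠ 0 := e ▸ h0
      have h2 := hmin _ (hC.normalize_mem hv hx zero_le_one ht.le h1)
      simpa only [one_smul] using h2
  rcases le_total 0 ⟪z, v.1⟫ with h | h
  · have h1 := key 1 one_pos
    have h2 : 1 + ⟪v.1, x.1⟫ ≤ ‖v.1 + (1 : ℝ) • x.1‖ := by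
      have := real_inner_le_norm v.1 (v.1 + (1 : ℝ) • x.1)
      rw [inner_add_right, real_inner_smul_right, inner_self_eq_one, norm_eq_of_mem_sphere] at this
      linarith
    nlinarith
  · refine le_of_forall_pos_le_add fun ε hε => ?_
    -- Small enough that the quadratic error $-\langle z,v\rangle t^2/2$ is at most $t\varepsilon$;
    -- the extra 1 keeps the denominator positive.
    have ht : 0 < ε / (1 - ⟪z, v.1⟫) := div_pos hε (by linarith)
    set t := ε / (1 - ⟪z, v.1⟫) with htdef
    have hε' : t * (1 - ⟪z, v.1⟫) = ε := div_mul_cancel₀ _ (by linarith)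
    have h1 := key t ht
    have h2 : ‖v.1 + t • x.1‖ ≤ 1 + t * ⟪v.1, x.1⟫ + t ^ 2 / 2 := by
      have h3 : ‖v.1 + t • x.1‖ ^ 2 = 1 + 2 * (t * ⟪v.1, x.1⟫) + t ^ 2 := by
        rw [norm_add_sq_real, norm_smul, norm_eq_of_mem_sphere, norm_eq_of_mem_sphere,
          real_inner_smul_right, mul_one, Real.norm_eq_abs, sq_abs]
        ring
      have := norm_le_half_one_add_sq (v.1 + t • x.1)
      linarith
    have h4 := mul_le_mul_of_nonpos_left h2 h
    have h5 : t * (⟪z, v.1⟫ * ⟪v.1, x.1⟫) ≤ t * (⟪z, x.1⟫ + ε) := by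
      nlinarith [mul_pos ht ht]
    exact le_of_mul_le_mul_left h5 ht

theorem exists_inner_eq_zero (hd : 1 ≤ d) (a : Sph d) : ∃ g : Sph d, ⟪g.1, a.1⟫ = 0 := by
  have h : (Submodule.span ℝ {a.1})ᗮ ≠ ⊥ := by
    rw [Ne, Submodule.orthogonal_eq_bot_iff]
    intro h
    have h1 := finrank_span_singleton (K := ℝ) (ne_zero_of_mem_unit_sphere a)
    rw [h, finrank_top, finrank_euclideanSpace_fin] at h1
    omega
  obtain ⟨v, hv, hv0⟩ := Submodule.exists_mem_ne_zero_of_ne_bot h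
  refine ⟨normalize v hv0, ?_⟩
  rw [real_inner_comm, inner_normalize, Submodule.mem_orthogonal_singleton_iff_inner_right.1 hv,
    mul_zero]

theorem exists_ne_of_nonempty_interior (hd : 1 ≤ d) {C : Set (Sph d)}
    (hC : (interior C).Nonempty) : ∃ a ∈ C, ∃ b ∈ C, a ≠ b := by
  obtain ⟨a, ha⟩ := hC
  obtain ⟨g, hg⟩ := exists_inner_eq_zero hd a
  by_contra! h
  have : C ⊆ hemisphere g := fun x hx => by
    rw [h x hx a (interior_subset ha), mem_hemisphere, hg]
  exact (inner_pos_of_mem_interior this ha).ne' hg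

/-! ### Bodies of constant diameter have constant width -/

/-- The point of the great circle through the orthogonal points `p` and `g` at distance `δ` from `p`
in the direction of `g`. -/
noncomputable def rotate {p g : Sph d} (hgp : ⟪g.1, p.1⟫ = 0) (δ : ℝ) : Sph d :=
  ⟨Real.cos δ • p.1 + Real.sin δ • g.1, by
    have h : ‖Real.cos δ • p.1 + Real.sin δ • g.1‖ ^ 2 = 1 := by
      rw [norm_add_sq_real, norm_smul, norm_smul, norm_eq_of_mem_sphere, norm_eq_of_mem_sphere,
        real_inner_smul_left, real_inner_smul_right, real_inner_comm, hgp, mul_one, mul_one,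
        Real.norm_eq_abs, Real.norm_eq_abs, sq_abs, sq_abs]
      linarith [Real.cos_sq_add_sin_sq δ]
    rw [mem_sphere_zero_iff_norm]
    exact (pow_eq_one_iff_of_nonneg (norm_nonneg _) two_ne_zero).1 h⟩

theorem inner_rotate {p g : Sph d} (hgp : ⟪g.1, p.1⟫ = 0) (δ : ℝ) (x : Sph d) :
    ⟪x.1, (rotate hgp δ).1⟫ = Real.cos δ * ⟪x.1, p.1⟫ + Real.sin δ * ⟪x.1, g.1⟫ := by
  rw [rotate, inner_add_right, real_inner_smul_right, real_inner_smul_right]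

/-- A complete set contains, with each of its boundary points `p` and each hemisphere supporting it
there, the point at distance `δ` from `p` in the direction of the center of the hemisphere. -/
theorem IsComplete.rotate_mem {K : Set (Sph d)} {δ : ℝ} (hδ₀ : 0 < δ) (hδ₁ : δ < Real.pi / 2)
    (hK : IsComplete K δ) {p g : Sph d} (hg : g ∈ polar K) (hp : p ∈ K) (hgp : ⟪g.1, p.1⟫ = 0) :
    rotate hgp δ ∈ K := by
  have hπ : δ ≤ Real.pi := by linarith [Real.pi_pos]
  have hcos : 0 < Real.cos δ := Real.cos_pos_of_mem_Ioo ⟨by linarith [Real.pi_pos], hδ₁⟩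
  have hsin : 0 < Real.sin δ := Real.sin_pos_of_pos_of_lt_pi hδ₀ (by linarith [Real.pi_pos])
  have hsc := Real.sin_sq_add_cos_sq δ
  refine hK.mem_of_forall_cos_le hδ₀.le hπ fun x hx => ?_
  by_contra! hlt
  rw [inner_rotate] at hlt
  set y := rotate hgp δ with hy
  have hpy : ⟪p.1, y.1⟫ = Real.cos δ := by
    rw [inner_rotate, inner_self_eq_one, real_inner_comm, hgp]
    ring
  have hgy : ⟪g.1, y.1⟫ = Real.sin δ := by
    rw [inner_rotate, inner_self_eq_one, hgp]
    ring
  have hG : 0 ≤ ⟪g.1, x.1⟫ := inner_nonneg_of_mem_polar hg hx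
  rw [real_inner_comm p.1 x.1, real_inner_comm g.1 x.1] at hlt
  -- The point $p$ is pushed along $v=x-ay$. The lower bound on $a$ makes $\langle g,v\rangle<0$, so
  -- $p$ leaves the hemisphere; the upper bound makes $\kappa>0$, so to first order $p$ stays within
  -- $\delta$ of $K$. The interval is nonempty exactly because $\langle x,y\rangle<\cos\delta$.
  obtain ⟨a, ha₁, ha₂⟩ : ∃ a, ⟪g.1, x.1⟫ / Real.sin δ < a ∧
      a < Real.cos δ * (1 - ⟪p.1, x.1⟫) / Real.sin δ ^ 2 := by
    refine exists_between ?_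
    rw [div_lt_div_iff₀ hsin (by positivity)]
    nlinarith
  have ha : 0 < a := (div_nonneg hG hsin.le).trans_lt ha₁
  rw [div_lt_iff₀ hsin] at ha₁
  rw [lt_div_iff₀ (by positivity)] at ha₂
  set v := x.1 - a • y.1 with hv
  set κ := Real.cos δ - a - Real.cos δ * ⟪p.1, v⟫ with hκ
  have hpv : ⟪p.1, v⟫ = ⟪p.1, x.1⟫ - a * Real.cos δ := by
    rw [hv, inner_sub_right, real_inner_smul_right, hpy]
  have hgv : ⟪g.1, v⟫ = ⟪g.1, x.1⟫ - a * Real.sin δ := by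
    rw [hv, inner_sub_right, real_inner_smul_right, hgy]
  have hκ0 : 0 < κ := by
    have : Real.sin δ ^ 2 = 1 - Real.cos δ ^ 2 := by linarith
    rw [this] at ha₂
    rw [hκ, hpv]
    linarith
  obtain ⟨ε, hε, hεκ⟩ : ∃ ε : ℝ, 0 < ε ∧ ε * (1 + ‖v‖ ^ 2) = κ :=
    ⟨κ / (1 + ‖v‖ ^ 2), by positivity, div_mul_cancel₀ _ (by positivity)⟩
  have hgw : ⟪g.1, p.1 + ε • v⟫ < 0 := by
    rw [inner_add_right, real_inner_smul_right, hgp, hgv]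
    nlinarith
  have hw : p.1 + ε • v ≠ 0 := by
    intro h
    rw [h, inner_zero_right] at hgw
    exact hgw.ne rfl
  have hnorm : ‖p.1 + ε • v‖ ≤ 1 + ε * ⟪p.1, v⟫ + ε ^ 2 * ‖v‖ ^ 2 / 2 := by
    have h1 : ‖p.1 + ε • v‖ ^ 2 = 1 + 2 * (ε * ⟪p.1, v⟫) + ε ^ 2 * ‖v‖ ^ 2 := by
      rw [norm_add_sq_real, norm_smul, norm_eq_of_mem_sphere, real_inner_smul_right, mul_pow,
        Real.norm_eq_abs, sq_abs]
      ring
    have := norm_le_half_one_add_sq (p.1 + ε • v)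
    linarith
  have hmem : normalize _ hw ∈ K := by
    refine hK.mem_of_forall_cos_le hδ₀.le hπ fun k hk => (le_inner_normalize_iff hw).2 ?_
    have h1 := cos_le_inner_of_diam hδ₀.le hπ hK.diam_eq hk hp
    have h2 := cos_le_inner_of_diam hδ₀.le hπ hK.diam_eq hk hx
    have h3 := mul_le_mul_of_nonneg_left (inner_le_one k y) ha.le
    have h4 : Real.cos δ - a ≤ ⟪k.1, v⟫ := by
      rw [hv, inner_sub_right, real_inner_smul_right]
      linarith
    rw [inner_add_right, real_inner_smul_right]
    have h5 := mul_le_mul_of_nonneg_left hnorm hcos.le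
    have h6 := mul_le_mul_of_nonneg_left h4 hε.le
    have h7 : Real.cos δ * (ε ^ 2 * ‖v‖ ^ 2 / 2) ≤ ε * κ := by
      rw [← hεκ]
      have h8 := mul_le_mul_of_nonneg_right (Real.cos_le_one δ)
        (by positivity : 0 ≤ ε ^ 2 * ‖v‖ ^ 2 / 2)
      nlinarith [mul_nonneg (sq_nonneg ε) (sq_nonneg ‖v‖), sq_nonneg ε]
    rw [hκ] at h7
    linarith
  have := inner_nonneg_of_mem_polar hg hmem
  rw [inner_normalize_nonneg_iff] at this
  linarith

theorem IsConstantDiameter.isConstantWidth {K : Set (Sph d)} {δ : ℝ} (hδ₀ : 0 < δ)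
    (hδ₁ : δ < Real.pi / 2) (hK : IsConstantDiameter K δ) : IsConstantWidth K δ := by
  have hπ : δ < Real.pi := by linarith [Real.pi_pos]
  have hcos : 0 < Real.cos δ := Real.cos_pos_of_mem_Ioo ⟨by linarith [Real.pi_pos], hδ₁⟩
  have hsin : 0 < Real.sin δ := Real.sin_pos_of_pos_of_lt_pi hδ₀ hπ
  have hsc := Real.sin_sq_add_cos_sq δ
  refine ⟨hK.isConvexBody, fun g hg => ?_⟩
  obtain ⟨hgK, p, hp, hgp⟩ := supports_iff.1 hg
  refine (hasWidth_iff hK.isConvexBody.nonempty_interior hgK hδ₀ hπ).2 ⟨?_, fun h hh => ?_⟩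
  · have hgp' : ⟪p.1, g.1⟫ = 0 := real_inner_comm p.1 g.1 ▸ hgp
    -- This is $h=\sin\delta\,p-\cos\delta\,g$, and $\sin\delta\,h=p-\cos\delta\,y$ with $y$ =
    -- `rotate hgp δ`. Hence $\langle x,p\rangle\ge\cos\delta$ and $\langle x,y\rangle\le 1$ give
    -- $\langle h,x\rangle\ge 0$.
    refine ⟨rotate hgp (δ - Real.pi / 2), mem_polar_iff.2 fun x hx => ?_, ?_⟩
    · rw [real_inner_comm, inner_rotate, Real.cos_sub_pi_div_two, Real.sin_sub_pi_div_two]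
      have h1 := cos_le_inner_of_diam hδ₀.le hπ.le hK.diam_eq hx hp
      have h2 := inner_le_one x (rotate hgp δ)
      rw [inner_rotate] at h2
      have h3 := mul_le_mul_of_nonneg_left h2 hcos.le
      have h4 : 0 ≤ Real.sin δ * (Real.sin δ * ⟪x.1, p.1⟫ + -Real.cos δ * ⟪x.1, g.1⟫) := by
        have : Real.sin δ * Real.sin δ = 1 - Real.cos δ ^ 2 := by linarith
        rw [mul_add, ← mul_assoc, this]
        linarith
      exact nonneg_of_mul_nonneg_right h4 hsin
    · rw [inner_rotate, Real.cos_sub_pi_div_two, Real.sin_sub_pi_div_two, hgp, inner_self_eq_one]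
      ring
  · have h1 := inner_nonneg_of_mem_polar hh
      ((hK.isComplete hδ₀ hδ₁).rotate_mem hδ₀ hδ₁ hgK hp hgp)
    rw [inner_rotate] at h1
    have h2 := inner_sq_add_inner_sq_le_one hgp h
    have h3 := inner_nonneg_of_mem_polar hh hp
    rw [real_inner_comm h.1 p.1, real_inner_comm h.1 g.1] at h2
    rw [real_inner_comm]
    -- If $\langle h,g\rangle<-\cos\delta$, then $\langle h,y\rangle\ge 0$ forces $\langle
    -- h,p\rangle>\sin\delta$, against Bessel's inequality for $p,g$.
    by_contra! hlt
    have h4 : (Real.sin δ * -⟪h.1, g.1⟫) ^ 2 ≤ (Real.cos δ * ⟪h.1, p.1⟫) ^ 2 :=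
      pow_le_pow_left₀ (mul_nonneg hsin.le (by linarith)) (by linarith) 2
    have h5 : Real.cos δ ^ 2 < ⟪h.1, g.1⟫ ^ 2 := by nlinarith
    have h6 : Real.sin δ ^ 2 = 1 - Real.cos δ ^ 2 := by linarith
    rw [mul_pow, mul_pow, h6] at h4
    nlinarith [mul_le_mul_of_nonneg_left h2 (sq_nonneg (Real.cos δ))]

/-! ### Bodies of constant width have constant diameter -/

theorem exists_forall_inner_le {C : Set (Sph d)} (hne : C.Nonempty) (hcl : IsClosed C) :
    ∃ a ∈ C, ∃ b ∈ C, ∀ x ∈ C, ∀ y ∈ C, ⟪a.1, b.1⟫ ≤ ⟪x.1, y.1⟫ := by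
  have hc : Continuous fun z : Sph d × Sph d => ⟪z.1.1, z.2.1⟫ := by fun_prop
  obtain ⟨⟨a, b⟩, ⟨ha, hb⟩, h⟩ :=
    (hcl.isCompact.prod hcl.isCompact).exists_isMinOn (hne.prod hne) hc.continuousOn
  exact ⟨a, ha, b, hb, fun x hx y hy => h (Set.mk_mem_prod hx hy)⟩

/-- Decomposition of a unit vector along `a` and a unit vector orthogonal to `a`. -/
theorem exists_unit_orthogonal {a b : Sph d} (h : a ≠ b) (h' : a ≠ -b) :
    ∃ g : Sph d, ∃ k : ℝ, 0 < k ∧ k ^ 2 = 1 - ⟪a.1, b.1⟫ ^ 2 ∧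
      b.1 = ⟪a.1, b.1⟫ • a.1 + k • g.1 ∧ ⟪g.1, a.1⟫ = 0 := by
  obtain ⟨g, hg⟩ := exists_isFacetCenter h h'
  obtain ⟨e, hk⟩ := hg.eq_add
  have hag := (isFacetCenter_iff.1 hg).1
  have hsq : ⟪b.1, g.1⟫ ^ 2 = 1 - ⟪a.1, b.1⟫ ^ 2 := by
    have := inner_self_eq_one b
    nth_rw 1 [e] at this
    rw [inner_add_left, real_inner_smul_left, real_inner_smul_left, real_inner_comm b.1 g.1] at this
    linarith
  refine ⟨g, ⟪b.1, g.1⟫, lt_of_le_of_ne hk fun h0 => ?_, hsq, e, real_inner_comm g.1 a.1 ▸ hag⟩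
  rw [← h0] at hsq
  linarith [one_sub_inner_sq_pos h h']

/-- Since $a$ is a point of $C$ farthest from $b$, the first-order condition shows that the
hemisphere bounded by the great sphere through $a$ orthogonal to the arc $ab$ supports $C$. -/
theorem IsConvex.mem_polar_of_forall_inner_le {C : Set (Sph d)} (hC : IsConvex C) {a b g : Sph d}
    {k : ℝ} (ha : a ∈ C) (hk : 0 < k) (hb : b.1 = ⟪a.1, b.1⟫ • a.1 + k • g.1)
    (hmin : ∀ x ∈ C, ⟪a.1, b.1⟫ ≤ ⟪b.1, x.1⟫) : g ∈ polar C := by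
  refine mem_polar_iff.2 fun x hx => ?_
  have h1 := hC.inner_mul_inner_le (z := b.1) ha hx fun y hy => by
    rw [real_inner_comm]
    exact hmin y hy
  rw [real_inner_comm] at h1
  have h2 : ⟪b.1, x.1⟫ = ⟪a.1, b.1⟫ * ⟪a.1, x.1⟫ + k * ⟪g.1, x.1⟫ := by
    nth_rw 1 [hb]
    rw [inner_add_left, real_inner_smul_left, real_inner_smul_left]
  exact nonneg_of_mul_nonneg_right (by linarith : 0 ≤ k * ⟪g.1, x.1⟫) hk

theorem IsConstantWidth.exists_inner_eq_cos {C : Set (Sph d)} {δ : ℝ} (hd : 1 ≤ d) (hδ₀ : 0 < δ)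
    (hδ₁ : δ < Real.pi / 2) (hC : IsConstantWidth C δ) :
    ∃ a ∈ C, ∃ b ∈ C, ⟪a.1, b.1⟫ = Real.cos δ ∧ ∀ x ∈ C, ∀ y ∈ C, Real.cos δ ≤ ⟪x.1, y.1⟫ := by
  have hπ : δ < Real.pi := by linarith [Real.pi_pos]
  have hcos : 0 < Real.cos δ := Real.cos_pos_of_mem_Ioo ⟨by linarith [Real.pi_pos], hδ₁⟩
  have hsin : 0 < Real.sin δ := Real.sin_pos_of_pos_of_lt_pi hδ₀ hπ
  have hsc := Real.sin_sq_add_cos_sq δ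
  obtain ⟨hcl, hconv, hint⟩ := hC.isConvexBody
  obtain ⟨a, ha, b, hb, hmin⟩ := exists_forall_inner_le (hint.mono interior_subset) hcl
  have hab' : a ≠ -b := (hconv b hb a ha).1
  have hba' : b ≠ -a := (hconv a ha b hb).1
  have hab : a ≠ b := by
    rintro rfl
    obtain ⟨x, hx, y, hy, hxy⟩ := exists_ne_of_nonempty_interior hd hint
    have := hmin x hx y hy
    rw [inner_self_eq_one] at this
    exact hxy (eq_of_inner_eq_one (le_antisymm (inner_le_one x y) this))
  obtain ⟨g, k, hk, hk2, hbg, hga⟩ := exists_unit_orthogonal hab hab'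
  obtain ⟨g', k', hk', hk2', hag', hgb'⟩ := exists_unit_orthogonal hab.symm hba'
  have hg : g ∈ polar C :=
    hconv.mem_polar_of_forall_inner_le ha hk hbg fun x hx => hmin b hb x hx
  have hg' : g' ∈ polar C := hconv.mem_polar_of_forall_inner_le hb hk' hag' fun x hx => by
    rw [real_inner_comm]
    exact hmin a ha x hx
  rw [real_inner_comm a.1 b.1] at hk2' hag'
  set u := ⟪a.1, b.1⟫ with hu
  obtain ⟨⟨h, hh, hgh⟩, hlb⟩ := (hasWidth_iff hint hg hδ₀ hπ).1
    (hC.hasWidth g (supports_iff.2 ⟨hg, a, ha, hga⟩))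
  have hkk : k = k' := by rw [← Real.sqrt_sq hk.le, ← Real.sqrt_sq hk'.le, hk2, hk2']
  -- The supporting hemispheres at $a$ and $b$ satisfy $\langle g,g'\rangle=-u$, so their lune has
  -- thickness $|ab|$, which is at least the width.
  have hle : u ≤ Real.cos δ := by
    have h2 : ⟪g.1, a.1⟫ = u * ⟪g.1, b.1⟫ + k' * ⟪g.1, g'.1⟫ := by
      nth_rw 1 [hag']
      rw [inner_add_right, real_inner_smul_right, real_inner_smul_right]
    have h3 : ⟪g.1, b.1⟫ = k := by
      rw [hbg, inner_add_right, real_inner_smul_right, real_inner_smul_right, hga,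
        inner_self_eq_one]
      ring
    rw [hga, h3, ← hkk] at h2
    have h4 : u + ⟪g.1, g'.1⟫ = 0 := by
      have : k * (u + ⟪g.1, g'.1⟫) = 0 := by linarith
      exact (mul_eq_zero.1 this).resolve_left hk.ne'
    linarith [hlb g' hg']
  -- A hemisphere realizing the width at $g$ must contain $b$; with Bessel's inequality for $a,g$
  -- this gives $(1-u^2)\cos^2\delta\le u^2\sin^2\delta$.
  have hge : Real.cos δ ≤ u := by
    have h1 := inner_nonneg_of_mem_polar hh hb
    rw [hbg, inner_add_right, real_inner_smul_right, real_inner_smul_right, real_inner_comm g.1 h.1,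
      hgh] at h1
    have h2 := inner_nonneg_of_mem_polar hh ha
    have h3 := inner_sq_add_inner_sq_le_one hga h
    rw [hgh, real_inner_comm h.1 a.1] at h3
    have h4 : 0 < u * ⟪h.1, a.1⟫ := by nlinarith [mul_pos hk hcos]
    have hu0 : 0 < u := pos_of_mul_pos_left h4 h2
    have h5 : (k * Real.cos δ) ^ 2 ≤ (u * ⟪h.1, a.1⟫) ^ 2 :=
      pow_le_pow_left₀ (by positivity) (by linarith) 2
    rw [mul_pow, mul_pow, hk2] at h5
    refine le_of_sq_le_sq ?_ hu0.le
    nlinarith [mul_le_mul_of_nonneg_left h3 (sq_nonneg u)]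
  have hueq := le_antisymm hle hge
  exact ⟨a, ha, b, hb, hueq, fun x hx y hy => hueq ▸ hmin x hx y hy⟩

theorem IsConstantWidth.isConstantDiameter {C : Set (Sph d)} {δ : ℝ} (hd : 1 ≤ d) (hδ₀ : 0 < δ)
    (hδ₁ : δ < Real.pi / 2) (hC : IsConstantWidth C δ) : IsConstantDiameter C δ := by
  have hπ : δ < Real.pi := by linarith [Real.pi_pos]
  have hcos : 0 < Real.cos δ := Real.cos_pos_of_mem_Ioo ⟨by linarith [Real.pi_pos], hδ₁⟩
  have hsin : 0 < Real.sin δ := Real.sin_pos_of_pos_of_lt_pi hδ₀ hπ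
  have hsc := Real.sin_sq_add_cos_sq δ
  obtain ⟨hcl, hconv, hint⟩ := hC.isConvexBody
  have hne := hint.mono interior_subset
  obtain ⟨a, ha, b, hb, hab, hmin⟩ := hC.exists_inner_eq_cos hd hδ₀ hδ₁
  refine ⟨hC.isConvexBody, le_antisymm ?_ ?_, fun p hp => ?_⟩
  · exact diam_le hδ₀.le fun x hx y hy => (sdist_le_iff hδ₀.le hπ.le).2 (hmin x hx y hy)
  · exact ((sdist_eq_iff hδ₀.le hπ.le).2 hab).ge.trans (sdist_le_diam ha hb)
  have hpC := hcl.frontier_subset hp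
  obtain ⟨g, hg, hgp⟩ := exists_polar_inner_eq_zero hne hconv hcl hp
  obtain ⟨⟨h, hh, hgh⟩, hlb⟩ := (hasWidth_iff hint hg hδ₀ hπ).1
    (hC.hasWidth g (supports_iff.2 ⟨hg, p, hpC, hgp⟩))
  -- The component of $g$ orthogonal to $h$; normalized, it is the center of the facet of the lune
  -- on $\mathrm{bd}(H)$.
  set v := g.1 + Real.cos δ • h.1 with hv
  have hvsq : ‖v‖ ^ 2 = Real.sin δ ^ 2 := by
    rw [hv, norm_add_sq_real, norm_smul, norm_eq_of_mem_sphere, norm_eq_of_mem_sphere,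
      real_inner_smul_right, hgh, Real.norm_eq_abs, mul_pow, sq_abs]
    linarith
  have hvn : ‖v‖ = Real.sin δ := by
    rw [← Real.sqrt_sq (norm_nonneg v), hvsq, Real.sqrt_sq hsin.le]
  have hv0 : v ≠ 0 := norm_ne_zero_iff.1 (hvn ▸ hsin.ne')
  have hqC : normalize v hv0 ∈ C := mem_of_forall_polar hne hconv hcl fun x hx => by
    rw [inner_normalize_nonneg_iff, hv, inner_add_right, real_inner_smul_right]
    -- The first-order condition is applied in the polar set, where $h$ minimizes $\langle
    -- g,\cdot\rangle$; it says $\langle v,x\rangle\ge 0$ for every polar $x$.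
    have := (isConvex_polar hint).inner_mul_inner_le (z := g.1) hh hx fun y hy => by
      rw [hgh]
      exact hlb y hy
    rw [hgh, real_inner_comm] at this
    rw [real_inner_comm x.1 g.1] at *
    linarith
  refine ⟨normalize v hv0, mem_frontier_of_inner_eq_zero hh hqC ?_,
    (sdist_eq_iff hδ₀.le hπ.le).2 (le_antisymm ?_ (hmin p hpC _ hqC))⟩
  · rw [inner_normalize, hv, inner_add_right, real_inner_smul_right, inner_self_eq_one,
      real_inner_comm, hgh]
    ring
  · rw [inner_normalize, hvn, hv, inner_add_right, real_inner_smul_right, real_inner_comm, hgp,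
      zero_add, ← div_eq_inv_mul, div_le_iff₀ hsin]
    have h1 := inner_sq_add_inner_sq_le_one hgp h
    rw [hgh] at h1
    exact mul_le_mul_of_nonneg_left (abs_le_of_sq_le_sq' (by nlinarith) hsin.le).2 hcos.le

end Sph

theorem theorem3 (d : ℕ) (hd : 2 ≤ d) (δ : ℝ) (hδ₀ : 0 < δ) (hδ₁ : δ < Real.pi / 2)
    (K : Set (Sph d)) :
    (Sph.IsConstantDiameter K δ ↔ Sph.IsComplete K δ) ∧
      (Sph.IsConstantDiameter K δ ↔ Sph.IsConstantWidth K δ) :=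
  ⟨⟨fun h => h.isComplete hδ₀ hδ₁, fun h => h.isConstantDiameter hδ₀ hδ₁⟩,
    ⟨fun h => h.isConstantWidth hδ₀ hδ₁,
      fun h => h.isConstantDiameter (one_le_two.trans hd) hδ₀ hδ₁⟩⟩
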